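/- A set $\mathcal A$ of infinite subsets of $\omega$ is an almost disjoint family if $\mathcal A$ is infinite and any two distinct elements of $\mathcal A$ have finite intersection; it is a mad family if it is maximal with respect to inclusion among almost disjoint families. For such $\mathcal A$ let $\mathcal I(\mathcal A)$ be the ideal of all $I\subseteq\omega$ for which there is a finite $\mathcal B\subseteq\mathcal A$ with $I\setminus\bigcup\mathcal B$ finite, and let $\mathcal F(\mathcal A)=\{\omega\setminus I: I\in\mathcal I(\mathcal A)\}$ be the dual filter. For a filter $\mathcal F$ on $\omega$, the Mathias forcing $\mathbb M_{\mathcal F}$ consists of all pairs $\langle s,F\rangle$ with $s\subseteq\omega$ finite, $F\in\mathcal F$ and $\max s<\min F$, where $\langle s,F\rangle$ is stronger than $\langle t,G\rangle$ if $F\subseteq G$, $s$ is an end-extension of $t$, and $s\setminus t\subseteq G$. A forcing notion adds a dominating real if it is forced, by every condition, that there is $x\in\omega^\omega$ such that for every $a\in\omega^\omega$ in the ground model, $a(n)\le x(n)$ for all but finitely many $n$. **Proposition.** There exists a mad family $\mathcal A$ on $\omega$ such that $\mathbb M_{\mathcal F(\mathcal A)}$ adds a dominating real. -/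

import Mathlib

/-! ### Almost disjoint families on `ω` and their ideals and filters -/

/-- An almost disjoint family on `ω`: an infinite set of infinite subsets of `ω`, any two
distinct elements of which have finite intersection. -/
structure IsAlmostDisjointFamily (A : Set (Set ℕ)) : Prop where
  infinite : A.Infinite
  infinite_of_mem : ∀ a ∈ A, a.Infinite
  finite_inter : ∀ a ∈ A, ∀ b ∈ A, a ≠ b → (a ∩ b).Finite

/-- A mad family on `ω`: an almost disjoint family that is maximal with respect to inclusion
among all almost disjoint families. -/
def IsMadFamily (A : Set (Set ℕ)) : Prop :=
  Maximal IsAlmostDisjointFamily A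

/-- The ideal `I(A)`: the sets `I ⊆ ω` that are contained, up to a finite set, in the union of
finitely many elements of `A`. -/
def idealOf (A : Set (Set ℕ)) : Set (Set ℕ) :=
  {I | ∃ B : Set (Set ℕ), B ⊆ A ∧ B.Finite ∧ (I \ ⋃₀ B).Finite}

/-- The filter `F(A)` dual to `I(A)`: `X ∈ F(A)` if and only if `ω \ X ∈ I(A)`. -/
def filterOf (A : Set (Set ℕ)) : Filter ℕ :=
  Filter.comk (fun I => I ∈ idealOf A)
    ⟨∅, Set.empty_subset A, Set.finite_empty, by simp⟩
    (fun _ ⟨B, hBA, hB, h⟩ _ hst => ⟨B, hBA, hB, h.subset (Set.sdiff_subset_sdiff_left hst)⟩)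
    (fun s ⟨B, hBA, hB, h⟩ t ⟨C, hCA, hC, k⟩ =>
      ⟨B ∪ C, Set.union_subset hBA hCA, hB.union hC, (h.union k).subset (by
        rw [Set.sUnion_union]
        rintro x ⟨hx | hx, hn⟩
        · exact Or.inl ⟨hx, fun hb => hn (Or.inl hb)⟩
        · exact Or.inr ⟨hx, fun hc => hn (Or.inr hc)⟩)⟩)

/-! ### Mathias forcing associated with a filter -/

/-- The conditions of the Mathias forcing `M_F`: pairs `⟨s, X⟩` with `s ⊆ ω` finite, `X ∈ F` and
`max s < min X`. -/
structure MathiasForcing (F : Filter ℕ) where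
  stem : Finset ℕ
  side : Set ℕ
  side_mem : side ∈ F
  stem_lt_side : ∀ i ∈ stem, ∀ j ∈ side, i < j

/-- `⟨s, X⟩` is stronger than `⟨t, Y⟩` (written `⟨s, X⟩ ≤ ⟨t, Y⟩`) if `X ⊆ Y`, `s` is an
end-extension of `t`, and `s \ t ⊆ Y`. -/
instance MathiasForcing.instPreorder (F : Filter ℕ) : Preorder (MathiasForcing F) where
  le p q :=
    p.side ⊆ q.side ∧
    (q.stem ⊆ p.stem ∧ ∀ i ∈ q.stem, ∀ j ∈ p.stem, j ∉ q.stem → i < j) ∧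
    ∀ j ∈ p.stem, j ∉ q.stem → j ∈ q.side
  le_refl p :=
    ⟨subset_rfl, ⟨subset_rfl, fun _ _ _ hj hn => absurd hj hn⟩, fun _ hj hn => absurd hj hn⟩
  le_trans p q r hpq hqr := by
    obtain ⟨h1, ⟨h2, h3⟩, h4⟩ := hpq
    obtain ⟨k1, ⟨k2, k3⟩, k4⟩ := hqr
    refine ⟨h1.trans k1, ⟨k2.trans h2, fun i hi j hj hjr => ?_⟩, fun j hj hjr => ?_⟩
    · by_cases hjq : j ∈ q.stem
      · exact k3 i hi j hjq hjr
      · exact h3 i (k2 hi) j hj hjq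
    · by_cases hjq : j ∈ q.stem
      · exact k4 j hjq hjr
      · exact k1 (h4 j hj hjq)

/-! ### Forcing

`P` is a forcing notion, and `q ≤ p` means that `q` is stronger than `p`.  A sentence `φ` of the
forcing language is represented by the predicate `p ↦ (p ⊩ φ)` on conditions; the definitions
below are the usual recursive clauses of the forcing relation.  -/

/-- A sentence of the forcing language, represented by the relation `p ⊩ φ`. -/
abbrev ForcingSentence (P : Type) : Type := P → Prop

namespace ForcingSentence

variable {P : Type} [Preorder P]

/-- `p ⊩ φ ∧ ψ` iff `p ⊩ φ` and `p ⊩ ψ`. -/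
def and (φ ψ : ForcingSentence P) : ForcingSentence P :=
  fun p => φ p ∧ ψ p

/-- `p ⊩ ¬ φ` iff no `q ≤ p` forces `φ`. -/
def neg (φ : ForcingSentence P) : ForcingSentence P :=
  fun p => ∀ q ≤ p, ¬ φ q

/-- Quantification over (the canonical names of) the elements `i` of a ground model set:
`p ⊩ ∀ i, φ i` iff `p ⊩ φ i` for all `i`. -/
def all {ι : Type} (φ : ι → ForcingSentence P) : ForcingSentence P :=
  fun p => ∀ i, φ i p

/-- Quantification over (the canonical names of) the elements `i` of a ground model set:
`p ⊩ ∃ i, φ i` iff the set of all `r` that force some `φ i` is dense below `p`. -/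
def ex {ι : Type} (φ : ι → ForcingSentence P) : ForcingSentence P :=
  fun p => ∀ q ≤ p, ∃ r ≤ q, ∃ i, φ i r

end ForcingSentence

/-- A `P`-name for a subset of `ω × ω`.  The name `τ` consists of the pairs `⟨(n, k)ˇ, c⟩` with
`c ∈ τ n k`; in the extension by a generic filter `G` it is evaluated to the set of all `(n, k)`
such that `τ n k ∩ G ≠ ∅`.  Every subset of `ω × ω` in a generic extension has such a name. -/
def RelName (P : Type) : Type := ℕ → ℕ → Set P

namespace RelName

variable {P : Type} [Preorder P]

/-- `p ⊩ (n, k) ∈ τ` iff the set of all `r` that are below some `c` with `⟨(n, k)ˇ, c⟩ ∈ τ` is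
dense below `p`. -/
def mem (τ : RelName P) (n k : ℕ) : ForcingSentence P :=
  fun p => ∀ q ≤ p, ∃ r ≤ q, ∃ c ∈ τ n k, r ≤ c

/-- The sentence "`τ` is (the graph of) a function from `ω` to `ω`": for every `n` there is `k`
with `(n, k) ∈ τ`, and there are no `k ≠ l` with `(n, k) ∈ τ` and `(n, l) ∈ τ`. -/
def isFunction (τ : RelName P) : ForcingSentence P :=
  ForcingSentence.all fun n : ℕ =>
    ForcingSentence.and
      (ForcingSentence.ex fun k : ℕ => τ.mem n k)
      (ForcingSentence.neg
        (ForcingSentence.ex fun kl : {kl : ℕ × ℕ // kl.1 ≠ kl.2} =>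
          ForcingSentence.and (τ.mem n kl.1.1) (τ.mem n kl.1.2)))

/-- The sentence "`a(n) ≤ τ(n)` for all but finitely many `n`", for a ground model function `a`:
there is `N` such that for all `n ≥ N` there is `k ≥ a(n)` with `(n, k) ∈ τ`. -/
def eventuallyDominates (τ : RelName P) (a : ℕ → ℕ) : ForcingSentence P :=
  ForcingSentence.ex fun N : ℕ =>
    ForcingSentence.all fun n : {n : ℕ // N ≤ n} =>
      ForcingSentence.ex fun k : {k : ℕ // a n.1 ≤ k} => τ.mem n.1 k.1

end RelName

/-- The forcing notion `P` adds a dominating real: there is a name `τ` such that it is forced (by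
every condition) that `τ` is an element of `ω^ω` and that, for every `a ∈ ω^ω` of the ground model,
`a(n) ≤ τ(n)` for all but finitely many `n`. -/
def AddsDominatingReal (P : Type) [Preorder P] : Prop :=
  ∃ τ : RelName P, ∀ p : P, τ.isFunction p ∧ ∀ a : ℕ → ℕ, τ.eventuallyDominates a p

/-
Identify `ω` with the nodes `σ ⌢ i` of `ω^{<ω}`.  For `x ∈ ω^ω` let `A_x` consist of the nodes
`(x ↾ j) ⌢ i` with `i ≤ x j`.  These sets are almost disjoint, and they remain so together with the
pieces of a partition of each fan `{σ ⌢ i | i ∈ ω}` into infinitely many infinite sets.  Let `A` be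
a mad family containing all of them.  Fans contain infinitely many members of `A`, so they are
positive and the generic set `G` meets each of them infinitely often, while `G ∩ A_x` is finite for
every ground model `x`.  Discarding the part of `G` below `n`, let `g_n σ` be the first element of
`G` in the fan of `σ`.  If `n` bounds `G ∩ A_x`, then `x j < g_n (x ↾ j)` for all `j`; so `x` is a
branch of a finitely branching tree computed from `g_n`, and `x n` is below the maximum of `g_n` on
the `n`-th level of that tree.  This maximum, as a function of `n`, is the dominating real.
-/

/-! ### Mad extensions and positive sets -/

theorem isAlmostDisjointFamily_range {ι : Type*} [Infinite ι] {f : ι → Set ℕ}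
    (hinf : ∀ i, (f i).Infinite) (hf : Pairwise fun i j => (f i ∩ f j).Finite) :
    IsAlmostDisjointFamily (Set.range f) where
  infinite := Set.infinite_range_of_injective fun i j hij => by
    by_contra hne
    have hfin : (f i ∩ f j).Finite := hf hne
    rw [hij, Set.inter_self] at hfin
    exact hinf j hfin
  infinite_of_mem := Set.forall_mem_range.2 hinf
  finite_inter := by
    rintro _ ⟨i, rfl⟩ _ ⟨j, rfl⟩ hij
    exact hf fun h => hij (congrArg f h)

theorem IsAlmostDisjointFamily.sUnion {c : Set (Set (Set ℕ))} (hne : c.Nonempty)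
    (hchain : IsChain (· ⊆ ·) c) (hc : ∀ A ∈ c, IsAlmostDisjointFamily A) :
    IsAlmostDisjointFamily (⋃₀ c) where
  infinite :=
    let ⟨A, hA⟩ := hne
    (hc A hA).infinite.mono (Set.subset_sUnion_of_mem hA)
  infinite_of_mem := fun a ⟨A, hA, ha⟩ => (hc A hA).infinite_of_mem a ha
  finite_inter := by
    rintro a ⟨A, hA, ha⟩ b ⟨B, hB, hb⟩ hab
    rcases hchain.total hA hB with h | h
    · exact (hc B hB).finite_inter a (h ha) b hb hab
    · exact (hc A hA).finite_inter a ha b (h hb) hab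

theorem IsAlmostDisjointFamily.exists_isMadFamily {A : Set (Set ℕ)}
    (hA : IsAlmostDisjointFamily A) : ∃ M, A ⊆ M ∧ IsMadFamily M :=
  zorn_subset_nonempty {B | IsAlmostDisjointFamily B}
    (fun c hc hchain hne => ⟨⋃₀ c, .sUnion hne hchain fun _ h => hc h,
      fun _ => Set.subset_sUnion_of_mem⟩) A hA

theorem mem_filterOf {A : Set (Set ℕ)} {X : Set ℕ} : X ∈ filterOf A ↔ Xᶜ ∈ idealOf A :=
  Iff.rfl

theorem compl_mem_filterOf_of_mem {A : Set (Set ℕ)} {a : Set ℕ} (ha : a ∈ A) :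
    aᶜ ∈ filterOf A := by
  rw [mem_filterOf, compl_compl]
  exact ⟨{a}, Set.singleton_subset_iff.2 ha, Set.finite_singleton a, by simp⟩

theorem filterOf_le_atTop (A : Set (Set ℕ)) : filterOf A ≤ Filter.atTop := by
  rw [← Nat.cofinite_eq_atTop]
  exact fun X hX => ⟨∅, Set.empty_subset A, Set.finite_empty, hX.subset Set.sdiff_subset⟩

theorem IsAlmostDisjointFamily.finite_subsets_of_mem_idealOf {A : Set (Set ℕ)}
    (hA : IsAlmostDisjointFamily A) {Y : Set ℕ} (hY : Y ∈ idealOf A) :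
    {a ∈ A | a ⊆ Y}.Finite := by
  obtain ⟨B, hBA, hB, hfin⟩ := hY
  refine hB.subset fun a ⟨haA, haY⟩ => ?_
  by_contra haB
  have hinter : (a ∩ ⋃₀ B).Finite := by
    rw [Set.sUnion_eq_biUnion, Set.inter_iUnion₂]
    exact hB.biUnion fun b hb => hA.finite_inter a haA b (hBA hb) fun h => haB (h ▸ hb)
  have hdiff : (a \ ⋃₀ B).Finite := hfin.subset (Set.sdiff_subset_sdiff_left haY)
  exact hA.infinite_of_mem a haA (Set.inter_union_sdiff a (⋃₀ B) ▸ hinter.union hdiff)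

theorem IsAlmostDisjointFamily.frequently_filterOf {A : Set (Set ℕ)}
    (hA : IsAlmostDisjointFamily A) {Y : Set ℕ} (hY : {a ∈ A | a ⊆ Y}.Infinite) :
    ∃ᶠ i in filterOf A, i ∈ Y := fun h => by
  have hYc : Yᶜ ∈ filterOf A := h
  rw [mem_filterOf, compl_compl] at hYc
  exact hY (hA.finite_subsets_of_mem_idealOf hYc)

/-! ### Branches, fans and finitely branching subtrees of `ω^{<ω}` -/

/-- The initial segment `x ↾ j` as a node of `ω^{<ω}`.  Nodes are lists in reverse order, so that
the immediate successors of `σ` are the lists `i :: σ`. -/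
def initSeg (x : ℕ → ℕ) : ℕ → List ℕ
  | 0 => []
  | j + 1 => x j :: initSeg x j

theorem length_initSeg (x : ℕ → ℕ) (j : ℕ) : (initSeg x j).length = j := by
  induction j with
  | zero => rfl
  | succ j ih => rw [initSeg, List.length_cons, ih]

theorem initSeg_injective (x : ℕ → ℕ) : Function.Injective (initSeg x) :=
  Function.LeftInverse.injective (length_initSeg x)

theorem length_eq_of_initSeg_eq {x y : ℕ → ℕ} {j k : ℕ}
    (h : initSeg x j = initSeg y k) : j = k := by
  rw [← length_initSeg x j, h, length_initSeg]

theorem apply_eq_of_initSeg_eq {x y : ℕ → ℕ} {j n : ℕ} (h : initSeg x j = initSeg y j)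
    (hn : n < j) : x n = y n := by
  induction j with
  | zero => exact absurd hn n.not_lt_zero
  | succ j ih =>
    obtain ⟨hhead, htail⟩ := List.cons.inj h
    rcases Nat.lt_succ_iff_lt_or_eq.1 hn with hn | rfl
    · exact ih htail hn
    · exact hhead

/-- The natural number standing for the immediate successor `σ ⌢ i` of the node `σ`. -/
def nodeCode (σ : List ℕ) (i : ℕ) : ℕ :=
  Nat.pair (Encodable.encode σ) i

theorem nodeCode_inj {σ τ : List ℕ} {i j : ℕ} :
    nodeCode σ i = nodeCode τ j ↔ σ = τ ∧ i = j := by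
  rw [nodeCode, nodeCode, Nat.pair_eq_pair, Encodable.encode_inj]

theorem le_nodeCode (σ : List ℕ) (i : ℕ) : i ≤ nodeCode σ i :=
  Nat.right_le_pair _ _

/-- The fan of `σ`: the set of all its immediate successors. -/
def fan (σ : List ℕ) : Set ℕ :=
  Set.range (nodeCode σ)

/-- The `k`-th piece of a partition of the fan of `σ` into infinitely many infinite sets. -/
def fanPiece (σ : List ℕ) (k : ℕ) : Set ℕ :=
  Set.range fun j => nodeCode σ (Nat.pair k j)

/-- The set `A_x` of all nodes `(x ↾ j) ⌢ i` with `i ≤ x j`. -/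
def branchSet (x : ℕ → ℕ) : Set ℕ :=
  {m | ∃ j, ∃ i ≤ x j, nodeCode (initSeg x j) i = m}

theorem fanPiece_subset_fan (σ : List ℕ) (k : ℕ) : fanPiece σ k ⊆ fan σ :=
  Set.range_comp_subset_range _ _

theorem infinite_fanPiece (σ : List ℕ) (k : ℕ) : (fanPiece σ k).Infinite :=
  Set.infinite_range_of_injective fun _ _ h => (Nat.pair_eq_pair.1 (nodeCode_inj.1 h).2).2

theorem disjoint_fanPiece {σ τ : List ℕ} {k l : ℕ} (h : (σ, k) ≠ (τ, l)) :
    Disjoint (fanPiece σ k) (fanPiece τ l) := by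
  rw [Set.disjoint_left]
  rintro _ ⟨i, rfl⟩ ⟨j, hj⟩
  obtain ⟨rfl, hpair⟩ := nodeCode_inj.1 hj
  exact h (by rw [(Nat.pair_eq_pair.1 hpair).1])

theorem fanPiece_injective (σ : List ℕ) : Function.Injective (fanPiece σ) := fun k l h => by
  by_contra hne
  have hdisj : Disjoint (fanPiece σ k) (fanPiece σ l) :=
    disjoint_fanPiece fun heq => hne (Prod.ext_iff.1 heq).2
  rw [h, disjoint_self] at hdisj
  exact (infinite_fanPiece σ l).nonempty.ne_empty hdisj

theorem infinite_branchSet (x : ℕ → ℕ) : (branchSet x).Infinite :=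
  Set.infinite_of_injective_forall_mem (f := fun j => nodeCode (initSeg x j) 0)
    (fun _ _ h => initSeg_injective x (nodeCode_inj.1 h).1) fun j => ⟨j, 0, Nat.zero_le _, rfl⟩

theorem finite_branchSet_inter_branchSet {x y : ℕ → ℕ} (h : x ≠ y) :
    (branchSet x ∩ branchSet y).Finite := by
  obtain ⟨n, hn⟩ := Function.ne_iff.1 h
  refine ((Set.finite_Iic n).biUnion fun j _ =>
    (Set.finite_Iic (x j)).image (nodeCode (initSeg x j))).subset ?_
  rintro _ ⟨⟨j, i, hi, rfl⟩, k, l, -, hkl⟩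
  have hseg := (nodeCode_inj.1 hkl).1
  obtain rfl := length_eq_of_initSeg_eq hseg
  have hkn : k ≤ n := not_lt.1 fun hlt => hn (apply_eq_of_initSeg_eq hseg hlt).symm
  exact Set.mem_biUnion hkn ⟨i, hi, rfl⟩

theorem finite_branchSet_inter_fan (x : ℕ → ℕ) (σ : List ℕ) : (branchSet x ∩ fan σ).Finite := by
  refine ((Set.finite_Iic (x σ.length)).image (nodeCode σ)).subset ?_
  rintro _ ⟨⟨j, i, hi, rfl⟩, l, hl⟩
  obtain ⟨rfl, -⟩ := nodeCode_inj.1 hl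
  exact ⟨i, by rwa [length_initSeg], rfl⟩

/-- The almost disjoint family of all sets `A_x` and all pieces of fans. -/
def branchFanFamily : Set (Set ℕ) :=
  Set.range (Sum.elim branchSet (Function.uncurry fanPiece))

theorem branchSet_mem_branchFanFamily (x : ℕ → ℕ) : branchSet x ∈ branchFanFamily :=
  ⟨.inl x, rfl⟩

theorem fanPiece_mem_branchFanFamily (σ : List ℕ) (k : ℕ) : fanPiece σ k ∈ branchFanFamily :=
  ⟨.inr (σ, k), rfl⟩

theorem isAlmostDisjointFamily_branchFanFamily : IsAlmostDisjointFamily branchFanFamily := by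
  have hfin (x : ℕ → ℕ) (σ : List ℕ) (k : ℕ) : (branchSet x ∩ fanPiece σ k).Finite :=
    (finite_branchSet_inter_fan x σ).subset
      (Set.inter_subset_inter_right _ (fanPiece_subset_fan σ k))
  refine isAlmostDisjointFamily_range ?_ ?_
  · rintro (x | ⟨σ, k⟩)
    exacts [infinite_branchSet x, infinite_fanPiece σ k]
  · rintro (x | ⟨σ, k⟩) (y | ⟨τ, l⟩) hne
    · exact finite_branchSet_inter_branchSet fun h => hne (congrArg Sum.inl h)
    · exact hfin x τ l
    · exact Set.inter_comm _ _ ▸ hfin y σ k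
    · have hdisj := disjoint_fanPiece fun h => hne (congrArg Sum.inr h)
      exact hdisj.inter_eq ▸ Set.finite_empty

/-- The `n`-th level of the finitely branching tree in which the immediate successors of a node `σ`
are the `σ ⌢ i` with `i < g σ`. -/
def treeLevel (g : List ℕ → ℕ) : ℕ → Finset (List ℕ)
  | 0 => {[]}
  | n + 1 => (treeLevel g n).biUnion fun σ => (Finset.range (g σ)).image (· :: σ)

/-- The maximum of `g` on the `n`-th level of the tree it defines: a bound for the `n`-th value of
the branches of this tree. -/
def treeBound (g : List ℕ → ℕ) (n : ℕ) : ℕ :=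
  (treeLevel g n).sup g

theorem initSeg_mem_treeLevel {g : List ℕ → ℕ} {x : ℕ → ℕ} {n : ℕ}
    (h : ∀ j < n, x j < g (initSeg x j)) : initSeg x n ∈ treeLevel g n := by
  induction n with
  | zero => exact Finset.mem_singleton_self _
  | succ n ih =>
    have hmem := ih fun j hj => h j (hj.trans n.lt_succ_self)
    exact Finset.mem_biUnion.2 ⟨_, hmem,
      Finset.mem_image_of_mem _ (Finset.mem_range.2 (h n n.lt_succ_self))⟩

theorem lt_treeBound {g : List ℕ → ℕ} {x : ℕ → ℕ} {n : ℕ}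
    (h : ∀ j ≤ n, x j < g (initSeg x j)) : x n < treeBound g n :=
  (h n le_rfl).trans_le (Finset.le_sup (initSeg_mem_treeLevel fun j hj => h j hj.le))

/-! ### Names for dominating reals -/

theorem RelName.mem_of_mem {P : Type} [Preorder P] {τ : RelName P} {n k : ℕ} {p : P}
    (hp : p ∈ τ n k) : τ.mem n k p :=
  fun q hq => ⟨q, le_rfl, p, hp, hq⟩

theorem AddsDominatingReal.of_isLowerSet {P : Type} [Preorder P] {τ : RelName P}
    (hlower : ∀ n k, IsLowerSet (τ n k))
    (hunique : ∀ n k l p, p ∈ τ n k → p ∈ τ n l → k = l)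
    (hdense : ∀ n p, ∃ q ≤ p, ∃ k, q ∈ τ n k)
    (hdom : ∀ (a : ℕ → ℕ) p, ∃ q ≤ p, ∃ N, ∀ n ≥ N, ∀ r ≤ q, ∀ k, r ∈ τ n k → a n ≤ k) :
    AddsDominatingReal P := by
  refine ⟨τ, fun p => ⟨fun n => ⟨fun q _ => ?_, fun q _ hex => ?_⟩, fun a q _ => ?_⟩⟩
  · obtain ⟨r, hrq, k, hr⟩ := hdense n q
    exact ⟨r, hrq, k, RelName.mem_of_mem hr⟩
  · obtain ⟨r, -, ⟨⟨k, l⟩, hne⟩, hk, hl⟩ := hex q le_rfl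
    obtain ⟨s, hsr, c, hc, hsc⟩ := hk r le_rfl
    obtain ⟨t, hts, d, hd, htd⟩ := hl s hsr
    exact hne (hunique n k l t (hlower n k (hts.trans hsc) hc) (hlower n l htd hd))
  · obtain ⟨r, hrq, N, hN⟩ := hdom a q
    refine ⟨r, hrq, N, fun ⟨n, hn⟩ s hsr => ?_⟩
    obtain ⟨t, hts, k, ht⟩ := hdense n s
    exact ⟨t, hts, ⟨k, hN n hn t (hts.trans hsr) k ht⟩, RelName.mem_of_mem ht⟩

namespace MathiasForcing

variable {F : Filter ℕ} {ι α β : Type*}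

/-! ### Deciding functions of the Mathias real -/

/-- The Ellentuck neighbourhood `[s, X]` of a condition `⟨s, X⟩`: the sets `G` with
`s ⊆ G ⊆ s ∪ X`. -/
def nhd (p : MathiasForcing F) : Set (Set ℕ) :=
  Set.Icc ↑p.stem (↑p.stem ∪ p.side)

theorem stem_mem_nhd (p : MathiasForcing F) : ↑p.stem ∈ p.nhd :=
  Set.left_mem_Icc.2 Set.subset_union_left

theorem stem_union_side_mem_nhd (p : MathiasForcing F) : ↑p.stem ∪ p.side ∈ p.nhd :=
  Set.right_mem_Icc.2 Set.subset_union_left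

theorem nhd_mono {p q : MathiasForcing F} (h : p ≤ q) : p.nhd ⊆ q.nhd := by
  obtain ⟨hside, ⟨hstem, -⟩, hnew⟩ := h
  refine Set.Icc_subset_Icc (Finset.coe_subset.2 hstem)
    (Set.union_subset (fun i hi => ?_) (hside.trans Set.subset_union_right))
  exact or_iff_not_imp_left.2 (hnew i hi)

/-- The condition `p` decides the value of `Φ` at the Mathias real to be `v`, in the strong sense
that `Φ` is constant on the neighbourhood of `p`. -/
def Decides (p : MathiasForcing F) (Φ : Set ℕ → α) (v : α) : Prop :=
  ∀ G ∈ p.nhd, Φ G = v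

theorem Decides.anti {p q : MathiasForcing F} {Φ : Set ℕ → α} {v : α} (h : q.Decides Φ v)
    (hpq : p ≤ q) : p.Decides Φ v :=
  fun G hG => h G (nhd_mono hpq hG)

theorem Decides.unique {p : MathiasForcing F} {Φ : Set ℕ → α} {v w : α} (hv : p.Decides Φ v)
    (hw : p.Decides Φ w) : v = w :=
  (hv _ p.stem_mem_nhd).symm.trans (hw _ p.stem_mem_nhd)

variable (F) in
/-- The conditions that decide `Φ` are dense. -/
def DenselyDecided (Φ : Set ℕ → α) : Prop :=
  ∀ p : MathiasForcing F, ∃ q ≤ p, ∃ v, q.Decides Φ v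

theorem denselyDecided_const (v : α) : DenselyDecided F fun _ => v :=
  fun p => ⟨p, le_rfl, v, fun _ _ => rfl⟩

theorem DenselyDecided.bind {Φ : Set ℕ → α} {Ψ : α → Set ℕ → β} (hΦ : DenselyDecided F Φ)
    (hΨ : ∀ v, DenselyDecided F (Ψ v)) : DenselyDecided F fun G => Ψ (Φ G) G := fun p => by
  obtain ⟨q, hqp, v, hv⟩ := hΦ p
  obtain ⟨r, hrq, w, hw⟩ := hΨ v q
  refine ⟨r, hrq.trans hqp, w, fun G hG => ?_⟩
  calc Ψ (Φ G) G = Ψ v G := by rw [hv.anti hrq G hG]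
    _ = w := hw G hG

theorem exists_le_forall_mem_decides {Φ : Set ℕ → ι → α}
    (hΦ : ∀ i, DenselyDecided F fun G => Φ G i) (S : Finset ι) (p : MathiasForcing F) :
    ∃ q ≤ p, ∀ i ∈ S, ∃ v, q.Decides (fun G => Φ G i) v := by
  induction S using Finset.cons_induction with
  | empty => exact ⟨p, le_rfl, by simp⟩
  | cons i S _ ih =>
    obtain ⟨q, hqp, hq⟩ := ih
    obtain ⟨r, hrq, v, hv⟩ := hΦ i q
    refine ⟨r, hrq.trans hqp, (Finset.forall_mem_cons _ _).2 ⟨⟨v, hv⟩, fun j hj => ?_⟩⟩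
    obtain ⟨w, hw⟩ := hq j hj
    exact ⟨w, hw.anti hrq⟩

theorem DenselyDecided.of_dependsOn {Φ : Set ℕ → ι → α}
    (hΦ : ∀ i, DenselyDecided F fun G => Φ G i) {S : Finset ι} {Ψ : (ι → α) → β}
    (hΨ : DependsOn Ψ S) : DenselyDecided F fun G => Ψ (Φ G) := fun p => by
  obtain ⟨q, hqp, hq⟩ := exists_le_forall_mem_decides hΦ S p
  refine ⟨q, hqp, Ψ (Φ q.stem), fun G hG => hΨ fun i hi => ?_⟩
  obtain ⟨v, hv⟩ := hq i hi
  exact (hv G hG).trans (hv _ q.stem_mem_nhd).symm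

theorem denselyDecided_treeLevel {γ : Set ℕ → List ℕ → ℕ}
    (hγ : ∀ σ, DenselyDecided F fun G => γ G σ) (n : ℕ) :
    DenselyDecided F fun G => treeLevel (γ G) n := by
  induction n with
  | zero => exact denselyDecided_const _
  | succ n ih =>
    have hsucc (L : Finset (List ℕ)) : DependsOn
        (fun g : List ℕ → ℕ => L.biUnion fun σ => (Finset.range (g σ)).image (· :: σ)) L :=
      fun g g' h => Finset.biUnion_congr rfl fun σ hσ => by rw [h σ hσ]
    exact ih.bind fun L => .of_dependsOn hγ (hsucc L)

theorem denselyDecided_treeBound {γ : Set ℕ → List ℕ → ℕ}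
    (hγ : ∀ σ, DenselyDecided F fun G => γ G σ) (n : ℕ) :
    DenselyDecided F fun G => treeBound (γ G) n := by
  have hsup (L : Finset (List ℕ)) : DependsOn (fun g : List ℕ → ℕ => L.sup g) L :=
    fun g g' h => Finset.sup_congr rfl h
  exact (denselyDecided_treeLevel hγ n).bind fun L => .of_dependsOn hγ (hsup L)

/-- The extension of a condition obtained by shrinking its side to `p.side ∩ X`. -/
def restrict (p : MathiasForcing F) {X : Set ℕ} (hX : X ∈ F) : MathiasForcing F where
  stem := p.stem
  side := p.side ∩ X
  side_mem := Filter.inter_mem p.side_mem hX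
  stem_lt_side i hi j hj := p.stem_lt_side i hi j hj.1

theorem restrict_le (p : MathiasForcing F) {X : Set ℕ} (hX : X ∈ F) : p.restrict hX ≤ p :=
  ⟨Set.inter_subset_left, ⟨subset_rfl, fun _ _ _ hj hn => absurd hj hn⟩,
    fun _ hj hn => absurd hj hn⟩

/-- The condition obtained by adding `m` to the stem of `p` and removing all `i ≤ m` from its side.
It extends `p` if `m` is in the side of `p`. -/
def adjoin (p : MathiasForcing F) (hF : F ≤ Filter.atTop) (m : ℕ) : MathiasForcing F where
  stem := insert m p.stem
  side := p.side ∩ Set.Ioi m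
  side_mem := Filter.inter_mem p.side_mem (hF (Filter.Ioi_mem_atTop m))
  stem_lt_side := (Finset.forall_mem_insert _ _ _).2
    ⟨fun _ hj => hj.2, fun i hi j hj => p.stem_lt_side i hi j hj.1⟩

theorem adjoin_le (p : MathiasForcing F) (hF : F ≤ Filter.atTop) {m : ℕ} (hm : m ∈ p.side) :
    p.adjoin hF m ≤ p := by
  have hnew : ∀ j ∈ (p.adjoin hF m).stem, j ∉ p.stem → j = m := fun j hj hn =>
    (Finset.mem_insert.1 hj).resolve_right hn
  refine ⟨Set.inter_subset_left, ⟨Finset.subset_insert _ _, fun i hi j hj hn => ?_⟩,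
    fun j hj hn => ?_⟩
  · exact hnew j hj hn ▸ p.stem_lt_side i hi m hm
  · exact hnew j hj hn ▸ hm

theorem denselyDecided_sInf (hF : F ≤ Filter.atTop) {Y : Set ℕ} (hY : ∃ᶠ i in F, i ∈ Y) :
    DenselyDecided F fun G => sInf (G ∩ Y) := fun p => by
  obtain ⟨m, hmY, hm⟩ := (hY.and_eventually p.side_mem).exists
  refine ⟨p.adjoin hF m, p.adjoin_le hF hm, sInf (↑(p.adjoin hF m).stem ∩ Y), fun G hG => ?_⟩
  set q := p.adjoin hF m
  have hmem : m ∈ (q.stem : Set ℕ) ∩ Y := ⟨Finset.mem_insert_self m _, hmY⟩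
  have hsub : (q.stem : Set ℕ) ∩ Y ⊆ G ∩ Y := Set.inter_subset_inter_left Y hG.1
  have hmin : sInf (G ∩ Y) ∈ G ∩ Y := Nat.sInf_mem ⟨m, hsub hmem⟩
  refine le_antisymm (Nat.sInf_le (hsub (Nat.sInf_mem ⟨m, hmem⟩))) (Nat.sInf_le ⟨?_, hmin.2⟩)
  -- Every element of `q.side` is above `m`, so the least element of `G ∩ Y` lies in the stem.
  exact (hG.2 hmin.1).resolve_right fun hside => (Nat.sInf_le (hsub hmem)).not_gt hside.2

/-! ### The dominating real -/

theorem addsDominatingReal_of_denselyDecided {H : Set ℕ → ℕ → ℕ}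
    (hdec : ∀ n, DenselyDecided F fun G => H G n)
    (hdom : ∀ (a : ℕ → ℕ) (s : Finset ℕ), ∃ Y ∈ F, ∃ N, ∀ n ≥ N, ∀ G ∈ F, G ⊆ ↑s ∪ Y →
      a n ≤ H G n) :
    AddsDominatingReal (MathiasForcing F) := by
  refine .of_isLowerSet (τ := fun n k => {p | p.Decides (fun G => H G n) k})
    (fun _ _ _ _ hqp hp => hp.anti hqp) (fun _ _ _ _ hk hl => hk.unique hl) hdec
    fun a p => ?_
  obtain ⟨Y, hY, N, hN⟩ := hdom a p.stem
  refine ⟨p.restrict hY, p.restrict_le hY, N, fun n hn r hr k hk => ?_⟩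
  have hsub : ↑r.stem ∪ r.side ⊆ ↑p.stem ∪ Y :=
    (nhd_mono hr r.stem_union_side_mem_nhd).2.trans
      (Set.union_subset_union_right _ Set.inter_subset_right)
  exact hk _ r.stem_union_side_mem_nhd ▸
    hN n hn _ (Filter.mem_of_superset r.side_mem Set.subset_union_right) hsub

end MathiasForcing

/-- The least element of `G` in the fan of `σ` that is at least `n`, with junk value `0` if there is
none. -/
noncomputable def firstInFan (G : Set ℕ) (n : ℕ) (σ : List ℕ) : ℕ :=
  sInf (G ∩ (fan σ ∩ Set.Ici n))

theorem lt_firstInFan {G : Set ℕ} {n : ℕ} {x : ℕ → ℕ} {j : ℕ}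
    (hfan : (G ∩ (fan (initSeg x j) ∩ Set.Ici n)).Nonempty)
    (hG : G ∩ branchSet x ⊆ Set.Iio n) : x j < firstInFan G n (initSeg x j) := by
  obtain ⟨hmG, ⟨i, hi⟩, hnm⟩ : firstInFan G n (initSeg x j) ∈ _ := Nat.sInf_mem hfan
  have hlt : x j < i := not_le.1 fun hle => (hG ⟨hmG, j, i, hle, hi⟩).not_ge (Set.mem_Ici.1 hnm)
  exact hi ▸ hlt.trans_le (le_nodeCode _ i)

theorem MathiasForcing.addsDominatingReal_of_fan_of_branchSet {F : Filter ℕ}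
    (hF : F ≤ Filter.atTop) (hfan : ∀ σ, ∃ᶠ i in F, i ∈ fan σ)
    (hbranch : ∀ x, (branchSet x)ᶜ ∈ F) : AddsDominatingReal (MathiasForcing F) := by
  have hpos (σ : List ℕ) (n : ℕ) : ∃ᶠ i in F, i ∈ fan σ ∩ Set.Ici n :=
    (hfan σ).and_eventually (hF (Filter.Ici_mem_atTop n))
  refine addsDominatingReal_of_denselyDecided (H := fun G n => treeBound (firstInFan G n) n)
    (fun n => denselyDecided_treeBound (fun σ => denselyDecided_sInf hF (hpos σ n)) n)
    fun a s => ?_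
  obtain ⟨N, hN⟩ := s.bddAbove
  refine ⟨_, hbranch a, N + 1, fun n hn G hGF hG => (lt_treeBound fun j _ => ?_).le⟩
  refine lt_firstInFan ((hpos _ n).and_eventually hGF |>.exists.imp fun _ h => h.symm) ?_
  exact fun i ⟨hiG, hia⟩ => (hN ((hG hiG).resolve_right fun h => h hia)).trans_lt hn

theorem proposition3p1 :
    ∃ A : Set (Set ℕ), IsMadFamily A ∧ AddsDominatingReal (MathiasForcing (filterOf A)) := by
  obtain ⟨A, hsub, hA⟩ := isAlmostDisjointFamily_branchFanFamily.exists_isMadFamily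
  have hfan (σ : List ℕ) : ∃ᶠ i in filterOf A, i ∈ fan σ :=
    hA.prop.frequently_filterOf <| Set.infinite_of_injective_forall_mem (fanPiece_injective σ)
      fun k => ⟨hsub (fanPiece_mem_branchFanFamily σ k), fanPiece_subset_fan σ k⟩
  have hbranch (x : ℕ → ℕ) : (branchSet x)ᶜ ∈ filterOf A :=
    compl_mem_filterOf_of_mem (hsub (branchSet_mem_branchFanFamily x))
  exact ⟨A, hA, MathiasForcing.addsDominatingReal_of_fan_of_branchSet (filterOf_le_atTop A)
    hfan hbranch⟩
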